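/- Let $p$ be a prime, $q$ a power of $p$, $m\ge 1$ an integer, $n=q^m-1$, let $\alpha$ be a primitive element of $GF(q^m)$, and let $\mathrm{Tr}$ be the trace from $GF(q^m)$ to $GF(q)$. Consider the sequence $s^\infty=(s_t)_{t\ge 0}$ over $GF(q)$ given by $s_t=\mathrm{Tr}\big((1+\alpha^t)^{q^m-2}\big)$ (with $0^0=1$ if $q^m=2$). Its minimal polynomial is $\mathbb{M}_s(x)=c_0+c_1x+\cdots+c_lx^l\in GF(q)[x]$, where $c_0=1$ and $l$ is the smallest positive integer for which there is a recurrence $-c_0s_i=c_1s_{i-1}+\cdots+c_ls_{i-l}$ for all $i\ge l$; the polynomial $\mathbb{M}_s$ exists and is unique. Let $\mathcal{C}_s=\langle \mathbb{M}_s(x)\rangle$ be the code of length $n$ over $GF(q)$ consisting of all $(a_0,\dots,a_{n-1})$ such that $a_0+a_1x+\cdots+a_{n-1}x^{n-1}$ lies in the ideal generated by $\mathbb{M}_s(x)$ in $GF(q)[x]/(x^n-1)$. Then $\mathcal{C}_s$ is a cyclic code, and its generator polynomial (the monic divisor of $x^n-1$ that generates the same ideal) is, up to a nonzero constant factor, $\mathbb{M}_s(x)$,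 and equals $$\prod_{\substack{0\le i<n\\ s_q(i)+m\not\equiv 0 \bmod p}}(x-\alpha^{-i}),$$ where $s_q(i)$ is the sum of the base-$q$ digits of $i$. Moreover $\mathcal{C}_s$ is an $[\,n,\ \frac{q^m}{p}-1,\ d\,]$ code, that is, it has length $n=q^m-1$, dimension $\frac{q^m}{p}-1$ and minimum distance $d$, where $$d\ \ge\ \max\Big\{2p-1,\ \frac{q(p-1)}{p}+1\Big\}.$$ (If $q^m=p$, the code is zero and its minimum distance is taken to be $+\infty$.) -/

import Mathlib

open Polynomial

/-- `IsFeedbackPoly s l M`: the polynomial `M = c₀ + c₁ x + ⋯ + c_l x^l` has `c₀ = 1` and the sequence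
`s` satisfies `-c₀ sᵢ = c₁ sᵢ₋₁ + c₂ sᵢ₋₂ + ⋯ + c_l sᵢ₋ₗ` for all `i ≥ l`. -/
def IsFeedbackPoly {F : Type*} [Field F] (s : ℕ → F) (l : ℕ) (M : F[X]) : Prop :=
  M.natDegree ≤ l ∧ M.coeff 0 = 1 ∧
    ∀ i, l ≤ i → -(M.coeff 0 * s i) = ∑ j ∈ Finset.Icc 1 l, M.coeff j * s (i - j)

/-- `l` is the linear span of `s`: the least positive length of a linear recurrence of `s`. -/
def IsLinearSpan {F : Type*} [Field F] (s : ℕ → F) (l : ℕ) : Prop :=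
  IsLeast {l : ℕ | 0 < l ∧ ∃ M : F[X], IsFeedbackPoly s l M} l

/-- `M` is the minimal polynomial (normalized by `c₀ = 1`) of the sequence `s`. -/
def IsSeqMinpoly {F : Type*} [Field F] (s : ℕ → F) (M : F[X]) : Prop :=
  ∃ l : ℕ, IsLinearSpan s l ∧ IsFeedbackPoly s l M

/-- The quotient ring `F[x] / (xⁿ - 1)`. -/
abbrev CyclicRing (F : Type*) [Field F] (n : ℕ) : Type _ :=
  F[X] ⧸ Ideal.span {(X ^ n - 1 : F[X])}

/-- The map `π : Fⁿ → F[x] / (xⁿ - 1)`,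
`(c₀, …, cₙ₋₁) ↦ c₀ + c₁ x + ⋯ + cₙ₋₁ xⁿ⁻¹`. -/
noncomputable def codePi (F : Type*) [Field F] (n : ℕ) : (Fin n → F) →ₗ[F] CyclicRing F n :=
  (Ideal.Quotient.mkₐ F (Ideal.span {(X ^ n - 1 : F[X])})).toLinearMap ∘ₗ
    ∑ i : Fin n, (Polynomial.monomial (i : ℕ)) ∘ₗ (LinearMap.proj i : (Fin n → F) →ₗ[F] F)

/-- The ideal `⟨g⟩` of `F[x] / (xⁿ - 1)`. -/
noncomputable def cyclicIdeal {F : Type*} [Field F] (n : ℕ) (g : F[X]) : Ideal (CyclicRing F n) :=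
  Ideal.span {Ideal.Quotient.mk (Ideal.span {(X ^ n - 1 : F[X])}) g}

/-- The code `⟨g⟩` of length `n`: all words `c` with `π c ∈ ⟨g⟩`. -/
noncomputable def codeOf {F : Type*} [Field F] (n : ℕ) (g : F[X]) : Submodule F (Fin n → F) :=
  ((cyclicIdeal n g).restrictScalars F).comap (codePi F n)

/-- A code is cyclic if `(c₀, …, cₙ₋₁) ∈ C` implies `(cₙ₋₁, c₀, …, cₙ₋₂) ∈ C`. -/
def IsCyclicCode {F : Type*} [Field F] {n : ℕ} (C : Submodule F (Fin n → F)) : Prop :=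
  ∀ c ∈ C, (fun i => c ((finRotate n).symm i)) ∈ C

/-- `g` is the generator polynomial of `C`: the monic divisor of `xⁿ - 1` with `π(C) = ⟨g⟩`. -/
def IsGeneratorPoly {F : Type*} [Field F] {n : ℕ} (C : Submodule F (Fin n → F)) (g : F[X]) :
    Prop :=
  g.Monic ∧ g ∣ X ^ n - 1 ∧ C.map (codePi F n) = (cyclicIdeal n g).restrictScalars F

open Classical in
/-- The minimum distance of a code: the least Hamming distance of two distinct codewords,
with value `⊤` when the code has only one word. -/
noncomputable def minDistance {F : Type*} [Field F] {n : ℕ} (C : Submodule F (Fin n → F)) : ℕ∞ :=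
  ⨅ (x ∈ C) (y ∈ C) (_ : x ≠ y), (hammingDist x y : ℕ∞)

/-- The sequence `s_t = Tr((1 + α^t)^e)`, with the trace from `K` to `F`. -/
noncomputable def traceSeq (F : Type*) {K : Type*} [Field F] [Field K] [Algebra F K]
    (α : K) (e : ℕ) (t : ℕ) : F :=
  Algebra.trace F K ((1 + α ^ t) ^ e)

/-- The sum `s_q(i)` of the base-`q` digits of `i`. -/
def digitSum (q i : ℕ) : ℕ := (Nat.digits q i).sum

/-! Write Q = q^m. In characteristic p, (1 - X)^(Q-2) = ∑_{i<Q} (i+1) X^i. Under the trace, each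
q-power Frobenius rotates the base-q digits of the exponent (because y^Q = y), and i + 1 depends
only on the last digit modulo p. Collecting powers gives y^i the coefficient s_q(i) + m, hence s_t =
∑ (-1)^i (s_q(i)+m) α^(it). The term i = Q-1 vanishes, since s_q(Q-1) + m = mq.

Thus s is a combination of distinct geometric sequences with nonzero coefficients, and a Vandermonde
argument shows that its recurrences are exactly the polynomials vanishing at the α^(-i)
(`isFeedbackPoly_iff`). Their product descends to F by Galois invariance, which gives the minimal
and the generator polynomial. The dimension comes from counting digit sums in a residue class. The
distance comes from the BCH bound: α^k is a zero as soon as p ∤ s_q(k), and two progressions of such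
k give the two bounds. -/

/-! ### Linear recurrences of sums of geometric sequences. -/

theorem eq_zero_of_sum_mul_pow_eq_zero {K ι : Type*} [Field K] (T : Finset ι) (x d : ι → K)
    (hx : Set.InjOn x T) (h : ∀ j < T.card, ∑ k ∈ T, d k * x k ^ j = 0) : ∀ k ∈ T, d k = 0 := by
  classical
  intro k hk
  -- Lagrange's trick: P vanishes at every node but `x k`, and its degree is small enough for the
  -- power-sum relations to apply to it.
  set P : K[X] := ∏ i ∈ T.erase k, (X - C (x i)) with hP
  have hdeg : P.natDegree < T.card := by
    rw [hP, natDegree_prod_of_monic _ _ fun i _ => monic_X_sub_C (x i)]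
    simpa using Finset.card_erase_lt_of_mem hk
  have h1 : ∑ i ∈ T, d i * P.eval (x i) = 0 := by
    simp_rw [eval_eq_sum_range' hdeg, Finset.mul_sum]
    rw [Finset.sum_comm]
    refine Finset.sum_eq_zero fun j hj => ?_
    simp_rw [mul_left_comm (d _), ← Finset.mul_sum, h j (Finset.mem_range.1 hj), mul_zero]
  rw [Finset.sum_eq_single_of_mem k hk] at h1
  · refine (mul_eq_zero.1 h1).resolve_right ?_
    rw [hP, eval_prod]
    refine Finset.prod_ne_zero_iff.2 fun i hi => ?_
    rw [Finset.mem_erase] at hi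
    simpa [sub_eq_zero] using fun e => hi.1 (hx hi.2 hk e.symm)
  · intro i hi hik
    rw [hP, eval_prod, Finset.prod_eq_zero (Finset.mem_erase.2 ⟨hik, hi⟩) (by simp), mul_zero]

theorem annihilates_iff_eval_inv_eq_zero {K ι : Type*} [Field K] (S : Finset ι) (c β : ι → K)
    (hc : ∀ k ∈ S, c k ≠ 0) (hβ : ∀ k ∈ S, β k ≠ 0) (hinj : Set.InjOn β S) (s : ℕ → K)
    (hs : ∀ t, s t = ∑ k ∈ S, c k * β k ^ t) {l : ℕ} {P : K[X]} (hP : P.natDegree ≤ l) :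
    (∀ i, l ≤ i → ∑ j ∈ Finset.range (l + 1), P.coeff j * s (i - j) = 0) ↔
      ∀ k ∈ S, P.eval (β k)⁻¹ = 0 := by
  have key : ∀ i, l ≤ i → ∑ j ∈ Finset.range (l + 1), P.coeff j * s (i - j) =
      ∑ k ∈ S, c k * β k ^ i * P.eval (β k)⁻¹ := by
    intro i hi
    simp_rw [hs, eval_eq_sum_range' (Nat.lt_succ_of_le hP), Finset.mul_sum]
    rw [Finset.sum_comm]
    refine Finset.sum_congr rfl fun k hk => Finset.sum_congr rfl fun j hj => ?_
    have hj' : j ≤ i := (Nat.lt_succ_iff.1 (Finset.mem_range.1 hj)).trans hi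
    rw [pow_sub₀ _ (hβ k hk) hj', inv_pow]
    ring
  constructor
  -- Only the instants l + j are used; the factor `β k ^ l` is absorbed into the coefficient.
  · intro h
    have h2 := eq_zero_of_sum_mul_pow_eq_zero S β (fun k => c k * β k ^ l * P.eval (β k)⁻¹) hinj
      (fun j _ => by
        rw [← h (l + j) (Nat.le_add_right _ _), key _ (Nat.le_add_right _ _)]
        exact Finset.sum_congr rfl fun k _ => by ring)
    intro k hk
    exact (mul_eq_zero.1 (h2 k hk)).resolve_left (mul_ne_zero (hc k hk) (pow_ne_zero _ (hβ k hk)))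
  · intro h i hi
    rw [key i hi]
    exact Finset.sum_eq_zero fun k hk => by rw [h k hk, mul_zero]

theorem prod_X_sub_C_dvd_iff {K ι : Type*} [Field K] (S : Finset ι) (x : ι → K)
    (hinj : Set.InjOn x S) (P : K[X]) :
    ∏ k ∈ S, (X - C (x k)) ∣ P ↔ ∀ k ∈ S, P.eval (x k) = 0 := by
  constructor
  · intro h k hk
    have hk' := Finset.dvd_prod_of_mem (fun k => X - C (x k)) hk
    exact dvd_iff_isRoot.1 (hk'.trans h)
  · intro h
    refine Finset.prod_dvd_of_coprime (fun i hi j hj hij => ?_) fun k hk => dvd_iff_isRoot.2 (h k hk)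
    have hne : x i - x j ≠ 0 := sub_ne_zero.2 fun e => hij (hinj hi hj e)
    exact isCoprime_X_sub_C_of_isUnit_sub hne.isUnit

theorem isFeedbackPoly_iff {F K ι : Type*} [Field F] [Field K] [Algebra F K] (S : Finset ι)
    (c β : ι → K) (hc : ∀ k ∈ S, c k ≠ 0) (hβ : ∀ k ∈ S, β k ≠ 0) (hinj : Set.InjOn β S)
    (s : ℕ → F) (hs : ∀ t, algebraMap F K (s t) = ∑ k ∈ S, c k * β k ^ t) (l : ℕ) (M : F[X]) :
    IsFeedbackPoly s l M ↔ M.natDegree ≤ l ∧ M.coeff 0 = 1 ∧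
      ∏ k ∈ S, (X - C (β k)⁻¹) ∣ M.map (algebraMap F K) := by
  have hinj' : Set.InjOn (fun k => (β k)⁻¹) S := fun i hi j hj e => hinj hi hj (inv_injective e)
  refine and_congr_right fun hM => and_congr_right fun _ => ?_
  rw [prod_X_sub_C_dvd_iff S (fun k => (β k)⁻¹) hinj', ← annihilates_iff_eval_inv_eq_zero S c β hc hβ hinj _ hs
    (natDegree_map_le.trans hM)]
  refine forall_congr' fun i => forall_congr' fun _ => ?_
  simp_rw [coeff_map, ← map_mul, ← map_sum]
  rw [map_eq_zero, Finset.range_eq_Ico, Finset.sum_eq_sum_Ico_succ_bot (Nat.succ_pos l), Nat.sub_zero,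
    neg_eq_iff_add_eq_zero]
  rfl

/-- Since s takes values in F, applying an automorphism to a recurrence of s gives another one. So G
divides each of its conjugates, and being monic of the same degree it equals them. -/
theorem exists_map_eq_prod_X_sub_C_inv {F K ι : Type*} [Field F] [Field K] [Algebra F K]
    [FiniteDimensional F K] [IsGalois F K] (S : Finset ι)
    (c β : ι → K) (hc : ∀ k ∈ S, c k ≠ 0) (hβ : ∀ k ∈ S, β k ≠ 0) (hinj : Set.InjOn β S)
    (s : ℕ → F) (hs : ∀ t, algebraMap F K (s t) = ∑ k ∈ S, c k * β k ^ t) :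
    ∃ g : F[X], g.map (algebraMap F K) = ∏ k ∈ S, (X - C (β k)⁻¹) := by
  set G : K[X] := ∏ k ∈ S, (X - C (β k)⁻¹) with hG
  have hinj' : Set.InjOn (fun k => (β k)⁻¹) S := fun i hi j hj e => hinj hi hj (inv_injective e)
  have hmon : G.Monic := monic_prod_of_monic _ _ fun k _ => monic_X_sub_C _
  have hann := (annihilates_iff_eval_inv_eq_zero S c β hc hβ hinj _ hs (le_refl G.natDegree)).2
    ((prod_X_sub_C_dvd_iff S (fun k => (β k)⁻¹) hinj' G).1 dvd_rfl)
  have hfix : ∀ σ : K ≃ₐ[F] K, G.map (σ : K →+* K) = G := by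
    intro σ
    refine eq_of_monic_of_dvd_of_natDegree_le hmon (hmon.map (σ : K →+* K)) ?_ natDegree_map_le
    rw [prod_X_sub_C_dvd_iff S (fun k => (β k)⁻¹) hinj',
      ← annihilates_iff_eval_inv_eq_zero S c β hc hβ hinj _ hs (natDegree_map_le (p := G))]
    intro i hi
    have := congrArg σ (hann i hi)
    simpa using this
  have hl : G ∈ Polynomial.lifts (algebraMap F K) := by
    rw [Polynomial.lifts_iff_coeff_lifts]
    intro j
    rw [← RingHom.coe_range]
    refine (IsGalois.mem_range_algebraMap_iff_fixed (F := F) (G.coeff j)).2 fun σ => ?_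
    conv_rhs => rw [← hfix σ, coeff_map]
    rfl
  exact (Polynomial.mem_lifts G).1 hl

/-- The feedback polynomials are the multiples of g with constant term 1, so the shortest length is
deg g and the cofactor is a constant. Nonemptiness of S makes that length positive. -/
theorem isSeqMinpoly_iff {F K ι : Type*} [Field F] [Field K] [Algebra F K] (S : Finset ι)
    (hS : S.Nonempty) (c β : ι → K) (hc : ∀ k ∈ S, c k ≠ 0) (hβ : ∀ k ∈ S, β k ≠ 0)
    (hinj : Set.InjOn β S)
    (s : ℕ → F) (hs : ∀ t, algebraMap F K (s t) = ∑ k ∈ S, c k * β k ^ t) (g : F[X])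
    (hg : g.map (algebraMap F K) = ∏ k ∈ S, (X - C (β k)⁻¹)) (M : F[X]) :
    IsSeqMinpoly s M ↔ M = C (g.coeff 0)⁻¹ * g := by
  have hdeg : g.natDegree = S.card := by
    rw [← natDegree_map (algebraMap F K), hg,
      natDegree_prod_of_monic _ _ fun k _ => monic_X_sub_C _]
    simp
  have hg0 : g.coeff 0 ≠ 0 := by
    rw [← (algebraMap F K).injective.ne_iff, map_zero, ← coeff_map, hg, coeff_zero_eq_eval_zero,
      eval_prod, Finset.prod_ne_zero_iff]
    intro k hk
    simpa using hβ k hk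
  have hgne : g ≠ 0 := fun h => hg0 (by simp [h])
  have hfb : ∀ l M, IsFeedbackPoly s l M ↔ M.natDegree ≤ l ∧ M.coeff 0 = 1 ∧ g ∣ M := by
    intro l M
    rw [isFeedbackPoly_iff S c β hc hβ hinj s hs, ← hg, map_dvd_map']
  have hM0 : ∀ l, S.card ≤ l → IsFeedbackPoly s l (C (g.coeff 0)⁻¹ * g) := by
    intro l hl
    rw [hfb]
    refine ⟨?_, ?_, dvd_mul_left _ _⟩
    · rw [natDegree_C_mul (inv_ne_zero hg0), hdeg]
      exact hl
    · rw [coeff_C_mul, inv_mul_cancel₀ hg0]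
  have hspan : IsLinearSpan s S.card := by
    refine ⟨⟨hS.card_pos, _, hM0 _ le_rfl⟩, ?_⟩
    rintro l ⟨_, M, hM⟩
    obtain ⟨h1, h2, h3⟩ := (hfb _ _).1 hM
    have hMne : M ≠ 0 := fun h => by simp [h] at h2
    rw [← hdeg]
    exact (natDegree_le_of_dvd h3 hMne).trans h1
  constructor
  · rintro ⟨l, hl, hM⟩
    rw [hl.unique hspan] at hM
    obtain ⟨h1, h2, u, rfl⟩ := (hfb _ _).1 hM
    have hu : u ≠ 0 := fun h => by simp [h] at h2
    rw [natDegree_mul hgne hu, hdeg] at h1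
    obtain ⟨a, rfl⟩ := natDegree_eq_zero.1 (show u.natDegree = 0 by omega)
    rw [mul_comm, coeff_C_mul] at h2
    rw [mul_comm g, eq_inv_of_mul_eq_one_left h2]
  · rintro rfl
    exact ⟨_, hspan, hM0 _ le_rfl⟩

/-! ### Cyclic codes: generator, dimension, BCH bound. -/

theorem codePi_apply {F : Type*} [Field F] (n : ℕ) (c : Fin n → F) :
    codePi F n c = Ideal.Quotient.mk (Ideal.span {(X ^ n - 1 : F[X])})
      (∑ i : Fin n, monomial (i : ℕ) (c i)) := by
  simp [codePi]

theorem codePi_mem_cyclicIdeal_iff {F : Type*} [Field F] {n : ℕ} {g : F[X]}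
    (hgd : g ∣ X ^ n - 1) (P : F[X]) :
    Ideal.Quotient.mk (Ideal.span {(X ^ n - 1 : F[X])}) P ∈ cyclicIdeal n g ↔ g ∣ P := by
  rw [cyclicIdeal, Ideal.mem_span_singleton]
  constructor
  · rintro ⟨u, hu⟩
    obtain ⟨u, rfl⟩ := Ideal.Quotient.mk_surjective u
    rw [← map_mul, Ideal.Quotient.eq, Ideal.mem_span_singleton] at hu
    simpa using (hgd.trans hu).add (dvd_mul_right g u)
  · exact fun h => map_dvd _ h

theorem mem_codeOf_iff {F : Type*} [Field F] {n : ℕ} {g : F[X]} (hgd : g ∣ X ^ n - 1)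
    (c : Fin n → F) : c ∈ codeOf n g ↔ g ∣ ∑ i : Fin n, monomial (i : ℕ) (c i) := by
  rw [← codePi_mem_cyclicIdeal_iff hgd, ← codePi_apply]
  rfl

theorem cyclicIdeal_eq_of_associated {F : Type*} [Field F] {n : ℕ} {M g : F[X]}
    (h : Associated M g) : cyclicIdeal n M = cyclicIdeal n g := by
  obtain ⟨u, rfl⟩ := h
  rw [cyclicIdeal, cyclicIdeal, map_mul]
  exact (Ideal.span_singleton_mul_right_unit (u.isUnit.map _) _).symm

theorem exists_sum_monomial_eq {F : Type*} [Field F] {n : ℕ} (P : F[X]) (hP : P.degree < n) :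
    ∃ c : Fin n → F, ∑ i : Fin n, monomial (i : ℕ) (c i) = P := by
  refine ⟨fun i => P.coeff i, ?_⟩
  rw [Fin.sum_univ_eq_sum_range (fun i => monomial i (P.coeff i))]
  by_cases h0 : P = 0
  · simp [h0]
  · exact (as_sum_range' P n ((natDegree_lt_iff_degree_lt h0).2 hP)).symm

theorem codePi_surjective {F : Type*} [Field F] {n : ℕ} (hn : 0 < n) :
    Function.Surjective (codePi F n) := by
  intro u
  obtain ⟨P, rfl⟩ := Ideal.Quotient.mk_surjective u
  have hmon : (X ^ n - 1 : F[X]).Monic := monic_X_pow_sub_C 1 hn.ne'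
  have hd : (P %ₘ (X ^ n - 1)).degree < n := by
    refine (degree_modByMonic_lt P hmon).trans_eq ?_
    exact degree_X_pow_sub_C hn 1
  obtain ⟨c, hc⟩ := exists_sum_monomial_eq _ hd
  refine ⟨c, ?_⟩
  rw [codePi_apply, hc, Ideal.Quotient.eq, Ideal.mem_span_singleton]
  exact ⟨-(P /ₘ (X ^ n - 1)), by rw [modByMonic_eq_sub_mul_div]; ring⟩

theorem isGeneratorPoly_codeOf {F : Type*} [Field F] {n : ℕ} (hn : 0 < n) {M g : F[X]}
    (hg : g.Monic) (hgd : g ∣ X ^ n - 1) (h : Associated M g) :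
    IsGeneratorPoly (codeOf n M) g := by
  refine ⟨hg, hgd, ?_⟩
  rw [codeOf, Submodule.map_comap_eq_of_surjective (codePi_surjective hn),
    cyclicIdeal_eq_of_associated h]

theorem isCyclicCode_codeOf {F : Type*} [Field F] (n : ℕ) (M : F[X]) :
    IsCyclicCode (codeOf n M) := by
  intro c hc
  obtain _ | n := n
  · convert hc
  · have key : codePi F (n + 1) (fun i => c ((finRotate (n + 1)).symm i)) =
        Ideal.Quotient.mk _ X * codePi F (n + 1) c := by
      rw [codePi_apply, codePi_apply, ← map_mul, Ideal.Quotient.eq, Ideal.mem_span_singleton,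
        ← Equiv.sum_comp (finRotate (n + 1)), Fin.sum_univ_castSucc, Fin.sum_univ_castSucc, mul_add,
        Finset.mul_sum]
      -- Shifting and multiplying by X differ only in the last coefficient, which wraps from degree
      -- n + 1 to degree 0.
      refine ⟨-C (c (Fin.last n)), ?_⟩
      have h0 : (finRotate (n + 1)).symm 0 = Fin.last n := by
        rw [Equiv.symm_apply_eq, finRotate_last]
      have : ∀ i : Fin n, ((finRotate (n + 1) i.castSucc : Fin (n + 1)) : ℕ) = i + 1 := by
        intro i
        rw [coe_finRotate_of_ne_last (by simp)]
        simp
      simp only [Equiv.symm_apply_apply, this, finRotate_last, Fin.val_zero, Fin.val_last,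
        Fin.val_castSucc, X_mul_monomial, h0]
      rw [← C_mul_X_pow_eq_monomial (n := n + 1), monomial_zero_left]
      ring
    change codePi F (n + 1) _ ∈ cyclicIdeal (n + 1) M
    rw [key]
    exact Ideal.mul_mem_left _ _ hc

theorem finrank_codeOf_add_natDegree {F : Type*} [Field F] {n : ℕ} {g : F[X]}
    (hg : g.Monic) (hgd : g ∣ X ^ n - 1) (hgn : g.natDegree ≤ n) :
    Module.finrank F (codeOf n g) + g.natDegree = n := by
  let f : (Fin n → F) →ₗ[F] AdjoinRoot g := (AdjoinRoot.mkₐ g).toLinearMap ∘ₗ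
    ∑ i : Fin n, (Polynomial.monomial (i : ℕ)) ∘ₗ (LinearMap.proj i : (Fin n → F) →ₗ[F] F)
  have hf : ∀ c, f c = AdjoinRoot.mk g (∑ i : Fin n, monomial (i : ℕ) (c i)) := by
    intro c
    simp [f]
  have hker : LinearMap.ker f = codeOf n g := by
    ext c
    rw [LinearMap.mem_ker, hf, AdjoinRoot.mk_eq_zero, mem_codeOf_iff hgd]
  have hsurj : LinearMap.range f = ⊤ := by
    rw [LinearMap.range_eq_top]
    intro u
    obtain ⟨P, rfl⟩ := AdjoinRoot.mk_surjective u
    have hd : (P %ₘ g).degree < n := by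
      refine (degree_modByMonic_lt P hg).trans_le ?_
      rw [degree_eq_natDegree hg.ne_zero]
      exact_mod_cast hgn
    obtain ⟨c, hc⟩ := exists_sum_monomial_eq _ hd
    refine ⟨c, ?_⟩
    rw [hf, hc, AdjoinRoot.mk_eq_mk]
    exact ⟨-(P /ₘ g), by rw [modByMonic_eq_sub_mul_div]; ring⟩
  have h := LinearMap.finrank_range_add_finrank_ker f
  rw [hsurj, finrank_top, hker, (AdjoinRoot.powerBasis hg.ne_zero).finrank,
    AdjoinRoot.powerBasis_dim, Module.finrank_fin_fun] at h
  omega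

/-- The BCH bound, for zeros in arithmetic progression of exponents. -/
theorem le_minDistance_codeOf {F K : Type*} [Field F] [Field K] [Algebra F K] {n : ℕ} {g : F[X]}
    (hgd : g ∣ X ^ n - 1) (γ : K) (hγ : IsPrimitiveRoot γ n) (a L : ℕ)
    (hz : ∀ j < L, aeval (γ ^ (a + j)) g = 0) :
    ((L + 1 : ℕ) : ℕ∞) ≤ minDistance (codeOf n g) := by
  classical
  unfold minDistance
  refine le_iInf₂ fun x hx => le_iInf₂ fun y hy => le_iInf fun hxy => ?_
  have hd : g ∣ _ := (mem_codeOf_iff hgd _).1 (sub_mem hx hy)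
  have hcast : hammingDist x y = (Finset.univ.filter fun i => x i ≠ y i).card := by
    unfold hammingDist
    congr
  by_contra hlt
  have hlt : (Finset.univ.filter fun i => x i ≠ y i).card ≤ L := by
    rw [← hcast]
    rw [not_le] at hlt
    have : hammingDist x y < L + 1 := by
      unfold hammingDist at hlt ⊢
      exact_mod_cast hlt
    omega
  set T := Finset.univ.filter fun i => x i ≠ y i with hT
  have hinj : Set.InjOn (fun i : Fin n => γ ^ (i : ℕ)) T := fun i _ j _ e =>
    Fin.ext (hγ.pow_inj i.2 j.2 e)
  -- The zeros give one Vandermonde relation per j on the support of x - y; the offset a goes into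
  -- the weights.
  have h := eq_zero_of_sum_mul_pow_eq_zero T (fun i : Fin n => γ ^ (i : ℕ))
    (fun i => algebraMap F K (x i - y i) * γ ^ (a * i)) hinj (fun j hj => by
      obtain ⟨u, hu⟩ := hd
      have := congrArg (aeval (γ ^ (a + j))) hu
      rw [map_mul, hz j (hj.trans_le hlt), zero_mul, map_sum] at this
      simp only [aeval_monomial, Pi.sub_apply] at this
      rw [← this]
      refine Finset.sum_subset_zero_on_sdiff (Finset.subset_univ _) ?_ ?_
      · intro i hi
        have : x i = y i := by simpa [hT] using hi
        simp [this]
      · intro i _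
        rw [← pow_mul, ← pow_mul, mul_assoc, ← pow_add]
        congr 2
        ring)
  obtain ⟨i, hi⟩ := Function.ne_iff.1 hxy
  have hγ0 : γ ≠ 0 := hγ.ne_zero (by have := i.2; omega)
  have := h i (by simpa [hT] using hi)
  simp [hγ0, sub_eq_zero, hi] at this

/-! ### The power expansion and base-q digit sums. -/

theorem one_sub_X_pow_eq_sum {K : Type*} [Field K] (p : ℕ) [Fact p.Prime] [CharP K p] {N : ℕ}
    (hN : 0 < N) :
    (1 - X : K[X]) ^ (p ^ N - 2) = ∑ i ∈ Finset.range (p ^ N), ((i : K[X]) + 1) * X ^ i := by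
  have hp := (Fact.out : p.Prime)
  have h2 : 2 ≤ p ^ N := hp.two_le.trans (Nat.le_self_pow hN.ne' p)
  have hne : (1 - X : K[X]) ^ 2 ≠ 0 := by
    refine pow_ne_zero _ fun h => ?_
    simpa using congrArg (eval 0) h
  have hsum : ∀ Q : ℕ, (1 - X : K[X]) ^ 2 * ∑ i ∈ Finset.range Q, ((i : K[X]) + 1) * X ^ i =
      1 - ((Q : K[X]) + 1) * X ^ Q + (Q : K[X]) * X ^ (Q + 1) := by
    intro Q
    induction Q with
    | zero => simp
    | succ Q ih =>
      rw [Finset.sum_range_succ, mul_add, ih]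
      push_cast
      ring
  refine mul_left_cancel₀ hne ?_
  rw [← pow_add, Nat.add_sub_cancel' h2, hsum, sub_pow_char_pow]
  have : ((p ^ N : ℕ) : K[X]) = 0 := by
    rw [CharP.cast_eq_zero_iff K[X] p]
    exact dvd_pow_self p hN.ne'
  rw [this]
  simp

theorem digitSum_eq_sum_range {q : ℕ} (hq : 2 ≤ q) (m : ℕ) :
    ∀ i < q ^ m, digitSum q i = ∑ j ∈ Finset.range m, i / q ^ j % q := by
  induction m with
  | zero =>
    intro i hi
    have : i = 0 := by simpa using hi
    simp [this, digitSum]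
  | succ m ih =>
    intro i hi
    have h1 : digitSum q i = i % q + digitSum q (i / q) := by
      rcases Nat.eq_zero_or_pos i with rfl | h
      · simp [digitSum]
      · simp [digitSum, Nat.digits_def' hq h]
    rw [h1, ih _ (Nat.div_lt_of_lt_mul (by rwa [pow_succ'] at hi)), Finset.sum_range_succ']
    simp [Nat.div_div_eq_div_mul, pow_succ', add_comm]

theorem digitSum_add_mul {q : ℕ} (hq : 2 ≤ q) {a : ℕ} (ha : a < q) (b : ℕ) :
    digitSum q (a + q * b) = a + digitSum q b := by
  rcases Nat.eq_zero_or_pos (a + q * b) with h | h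
  · have ha0 : a = 0 := by omega
    have hb : b = 0 := by
      have : q * b = 0 := by omega
      exact (Nat.mul_eq_zero.1 this).resolve_left (by omega)
    simp [ha0, hb]
  · simp [digitSum, Nat.digits_def' hq h, Nat.add_mul_mod_self_left, Nat.mod_eq_of_lt ha,
      Nat.add_mul_div_left _ _ (show 0 < q by omega), Nat.div_eq_of_lt ha]

theorem digitSum_of_lt {q : ℕ} (hq : 2 ≤ q) {a : ℕ} (ha : a < q) : digitSum q a = a := by
  simpa [digitSum] using digitSum_add_mul hq ha 0

/-- Subtracting from q^m - 1 complements each digit to q - 1, without borrowing. -/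
theorem digitSum_pow_sub_one_sub {q : ℕ} (hq : 2 ≤ q) (m : ℕ) :
    ∀ i < q ^ m, digitSum q (q ^ m - 1 - i) + digitSum q i = m * (q - 1) := by
  induction m with
  | zero =>
    intro i hi
    have : i = 0 := by simpa using hi
    simp [this, digitSum]
  | succ m ih =>
    intro i hi
    have hr : i % q < q := Nat.mod_lt _ (by omega)
    have hb : i / q < q ^ m := Nat.div_lt_of_lt_mul (by rwa [pow_succ'] at hi)
    have e1 : i = i % q + q * (i / q) := (Nat.mod_add_div i q).symm
    have e2 : q ^ (m + 1) - 1 - i = (q - 1 - i % q) + q * (q ^ m - 1 - i / q) := by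
      obtain ⟨k, hk⟩ := Nat.exists_eq_add_of_lt hb
      have h3 : q ^ m - 1 - i / q = k := by omega
      rw [h3, pow_succ', hk]
      have : q * (i / q + k + 1) = q * (i / q) + q * k + q := by ring
      omega
    rw [e2, digitSum_add_mul hq (by omega)]
    conv_lhs => enter [2]; rw [e1, digitSum_add_mul hq hr]
    have := ih _ hb
    rw [add_mul, one_mul]
    omega

/-- The number of `m`-digit numbers whose digit sum has a prescribed residue. -/
theorem card_filter_digitSum_modEq {p q m : ℕ} (hp : p.Prime) (hpq : p ∣ q) (hq : 2 ≤ q)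
    (hm : 0 < m) (r : ℕ) :
    ((Finset.range (q ^ m)).filter fun i => digitSum q i + r ≡ 0 [MOD p]).card = q ^ m / p := by
  have hp0 := hp.pos
  obtain ⟨k, rfl⟩ := hpq
  -- As p ∣ q, no carry occurs inside a block of p consecutive integers starting at a multiple of p.
  -- The digit sums there run through all residues, so each block has exactly one solution.
  have hblock : ∀ u v, v < p → digitSum (p * k) (p * u + v) = digitSum (p * k) (p * u) + v := by
    intro u v hv
    have hk : 0 < k := Nat.pos_of_ne_zero fun h => by simp [h] at hq
    have hlt : p * (u % k) + p ≤ p * k := by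
      have : u % k + 1 ≤ k := Nat.mod_lt _ hk
      calc p * (u % k) + p = p * (u % k + 1) := by ring
        _ ≤ p * k := Nat.mul_le_mul_left _ this
    have hu : p * u = p * (u % k) + p * k * (u / k) := by
      conv_lhs => rw [← Nat.mod_add_div u k]
      ring
    rw [hu, add_right_comm, digitSum_add_mul hq (by omega), digitSum_add_mul hq (by omega)]
    ring
  have hdvd : p ∣ (p * k) ^ m := (dvd_mul_right p k).trans (dvd_pow_self _ hm.ne')
  obtain ⟨N, hN⟩ := hdvd
  rw [hN, Nat.mul_div_cancel_left _ hp0, ← Finset.card_range N]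
  refine Finset.card_bij' (fun i _ => i / p)
    (fun u _ => p * u + (p - (digitSum (p * k) (p * u) + r) % p) % p) ?_ ?_ ?_ ?_
  · intro i hi
    simp only [Finset.mem_filter, Finset.mem_range] at hi ⊢
    rw [Finset.card_range] at hi
    exact Nat.div_lt_of_lt_mul hi.1
  · intro u hu
    have hv : (p - (digitSum (p * k) (p * u) + r) % p) % p < p := Nat.mod_lt _ hp0
    simp only [Finset.mem_filter, Finset.mem_range] at hu ⊢
    rw [Finset.card_range]
    refine ⟨?_, ?_⟩
    · have := Nat.mul_le_mul_left p (show u + 1 ≤ N from hu)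
      rw [mul_add, mul_one] at this
      omega
    · rw [hblock _ _ hv]
      set A := digitSum (p * k) (p * u) + r with hA
      rw [add_right_comm, ← hA]
      have hAp : A % p < p := Nat.mod_lt _ hp0
      have : A + (p - A % p) ≡ 0 [MOD p] := by
        refine (Nat.modEq_zero_iff_dvd).2 ?_
        have := Nat.mod_add_div A p
        exact ⟨A / p + 1, by rw [mul_add, mul_one]; omega⟩
      exact (Nat.ModEq.add_left _ (Nat.mod_modEq _ _)).trans this
  · intro i hi
    simp only [Finset.mem_filter, Finset.mem_range] at hi
    have e := Nat.div_add_mod i p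
    have hv : i % p < p := Nat.mod_lt _ hp0
    have h1 := hi.2
    rw [← e, hblock _ _ hv] at h1
    set A := digitSum (p * k) (p * (i / p)) + r with hA
    have h2 : A + i % p ≡ 0 [MOD p] := by rwa [hA, add_right_comm]
    have h3 : A + (p - A % p) % p ≡ 0 [MOD p] := by
      have : A + (p - A % p) ≡ 0 [MOD p] := by
        refine (Nat.modEq_zero_iff_dvd).2 ?_
        have := Nat.mod_add_div A p
        have hAp : A % p < p := Nat.mod_lt _ hp0
        exact ⟨A / p + 1, by rw [mul_add, mul_one]; omega⟩
      exact (Nat.ModEq.add_left _ (Nat.mod_modEq _ _)).trans this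
    have h4 := Nat.ModEq.add_left_cancel' A (h3.trans h2.symm)
    have h5 := Nat.ModEq.eq_of_lt_of_lt h4 (Nat.mod_lt _ hp0) hv
    simp only [h5]
    exact e
  · intro u hu
    have hv : (p - (digitSum (p * k) (p * u) + r) % p) % p < p := Nat.mod_lt _ hp0
    rw [Nat.mul_add_div hp0, Nat.div_eq_of_lt hv, add_zero]

/-- Summing over the cyclic shifts of the `m` base-`q` digits. -/
theorem sum_range_pow_rotate {R : Type*} [AddCommMonoid R] {q m j : ℕ} (hq : 2 ≤ q) (hj : j ≤ m)
    (f : ℕ → R) :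
    ∑ i ∈ Finset.range (q ^ m), f (i / q ^ j + i % q ^ j * q ^ (m - j)) =
      ∑ i ∈ Finset.range (q ^ m), f i := by
  have hpos : ∀ k, 0 < q ^ k := fun k => Nat.pow_pos (by omega)
  have hmul : q ^ j * q ^ (m - j) = q ^ m := by rw [← pow_add, Nat.add_sub_cancel' hj]
  refine Finset.sum_bij' (fun i _ => i / q ^ j + i % q ^ j * q ^ (m - j))
    (fun i _ => i / q ^ (m - j) + i % q ^ (m - j) * q ^ j) ?_ ?_ ?_ ?_ fun _ _ => rfl
  · intro i hi
    rw [Finset.mem_range] at hi ⊢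
    rw [← hmul] at hi ⊢
    have h1 := Nat.div_lt_of_lt_mul hi
    have h2 := Nat.mod_lt i (hpos j)
    calc _ < q ^ (m - j) + i % q ^ j * q ^ (m - j) := by omega
      _ = (i % q ^ j + 1) * q ^ (m - j) := by ring
      _ ≤ _ := Nat.mul_le_mul_right _ h2
  · intro i hi
    rw [Finset.mem_range, ← hmul, mul_comm] at hi
    rw [Finset.mem_range, ← hmul, mul_comm (q ^ j) (q ^ (m - j))]
    have h1 := Nat.div_lt_of_lt_mul hi
    have h2 := Nat.mod_lt i (hpos (m - j))
    calc _ < q ^ j + i % q ^ (m - j) * q ^ j := by omega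
      _ = (i % q ^ (m - j) + 1) * q ^ j := by ring
      _ ≤ _ := Nat.mul_le_mul_right _ h2
  · intro i hi
    rw [Finset.mem_range, ← hmul] at hi
    have h1 := Nat.div_lt_of_lt_mul hi
    rw [Nat.add_mul_div_right _ _ (hpos _), Nat.div_eq_of_lt h1, Nat.add_mul_mod_self_right,
      Nat.mod_eq_of_lt h1, zero_add, mul_comm, Nat.mod_add_div]
  · intro i hi
    rw [Finset.mem_range, ← hmul, mul_comm] at hi
    have h1 := Nat.div_lt_of_lt_mul hi
    rw [Nat.add_mul_div_right _ _ (hpos _), Nat.div_eq_of_lt h1, Nat.add_mul_mod_self_right,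
      Nat.mod_eq_of_lt h1, zero_add, mul_comm, Nat.mod_add_div]

/-! ### The trace sequence as a power sum. -/

theorem algebraMap_trace_one_sub_pow {p q m : ℕ} (hp : p.Prime) {F K : Type*} [Field F] [Finite F]
    [Field K] [Finite K] [Algebra F K] [CharP F p] (hq : Nat.card F = q)
    (hm : Module.finrank F K = m) (y : K) :
    algebraMap F K (Algebra.trace F K ((1 - y) ^ (q ^ m - 2))) =
      ∑ i ∈ Finset.range (q ^ m), ((digitSum q i + m : ℕ) : K) * y ^ i := by
  have := Fact.mk hp
  have hKp : CharP K p := charP_of_injective_algebraMap (algebraMap F K).injective p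
  have : Fintype F := Fintype.ofFinite F
  have : Fintype K := Fintype.ofFinite K
  have hmpos : 0 < m := hm ▸ Module.finrank_pos
  obtain ⟨N, hN, hqN⟩ := FiniteField.card F p
  rw [← Nat.card_eq_fintype_card, hq] at hqN
  have hN0 : (0 : ℕ) < N := N.pos
  have hq2 : 2 ≤ q := by rw [hqN]; exact hp.two_le.trans (Nat.le_self_pow hN0.ne' p)
  have hyQ : y ^ q ^ m = y := by
    have hc : Fintype.card K = q ^ m := by
      rw [Module.card_eq_pow_finrank (K := F), hm, ← Nat.card_eq_fintype_card, hq]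
    rw [← hc, FiniteField.pow_card]
  have hq0 : (q : K) = 0 := by
    rw [CharP.cast_eq_zero_iff K p, hqN]
    exact dvd_pow_self p hN0.ne'
  have hexp : (1 - y) ^ (q ^ m - 2) = ∑ i ∈ Finset.range (q ^ m), ((i : K) + 1) * y ^ i := by
    have := congrArg (eval y) (one_sub_X_pow_eq_sum (K := K) p (Nat.mul_pos hN0 hmpos))
    rw [pow_mul, ← hqN] at this
    simpa [eval_finsetSum] using this
  rw [FiniteField.algebraMap_trace_eq_sum_pow, hm, hexp]
  have hfrob : ∀ j, (∑ i ∈ Finset.range (q ^ m), ((i : K) + 1) * y ^ i) ^ q ^ j =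
      ∑ i ∈ Finset.range (q ^ m), ((i : K) + 1) * y ^ (i * q ^ j) := by
    intro j
    have e : q ^ j = p ^ ((N : ℕ) * j) := by rw [hqN, pow_mul]
    rw [e, sum_pow_char_pow (p := p)]
    refine Finset.sum_congr rfl fun i _ => ?_
    rw [mul_pow, ← pow_mul, add_pow_char_pow (p := p), one_pow]
    congr 2
    exact map_natCast (iterateFrobenius K p (N * j)) i
  rw [hq]
  calc _ = ∑ j ∈ Finset.range m, ∑ i ∈ Finset.range (q ^ m),
        (((i / q ^ j % q : ℕ) : K) + 1) * y ^ i := by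
        refine Finset.sum_congr rfl fun j hj => ?_
        rw [Finset.mem_range] at hj
        -- After rotation by j digits, y^Q = y turns the exponent back into i, while the coefficient
        -- sees only the j-th digit of i modulo p.
        rw [hfrob, ← sum_range_pow_rotate hq2 hj.le]
        refine Finset.sum_congr rfl fun i _ => ?_
        congr 1
        · have h1 : ((q ^ (m - j) : ℕ) : K) = 0 := by
            rw [Nat.cast_pow, hq0, zero_pow (by omega)]
          have h2 : ((i / q ^ j : ℕ) : K) = ((i / q ^ j % q : ℕ) : K) := by
            conv_lhs => rw [← Nat.mod_add_div (i / q ^ j) q, Nat.cast_add, Nat.cast_mul, hq0]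
            ring
          rw [Nat.cast_add, Nat.cast_mul, h1, h2]
          ring
        · rw [add_mul, mul_assoc, ← pow_add, Nat.sub_add_cancel hj.le, pow_add, mul_comm (i % _),
            pow_mul y (q ^ m), hyQ, ← pow_add, Nat.div_add_mod']
    _ = _ := by
        rw [Finset.sum_comm]
        refine Finset.sum_congr rfl fun i hi => ?_
        rw [← Finset.sum_mul, digitSum_eq_sum_range hq2 m i (Finset.mem_range.1 hi)]
        simp [Finset.sum_add_distrib]

theorem digitSum_pow_sub_one_add {q : ℕ} (hq : 2 ≤ q) (m : ℕ) :
    digitSum q (q ^ m - 1) + m = m * q := by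
  have h := digitSum_pow_sub_one_sub hq m 0 (Nat.pow_pos (by omega))
  rw [Nat.sub_zero, digitSum_of_lt hq (a := 0) (by omega), add_zero] at h
  obtain ⟨k, rfl⟩ := Nat.exists_eq_add_of_le' (show 1 ≤ q by omega)
  rw [h, Nat.add_sub_cancel]
  ring

theorem algebraMap_traceSeq_eq_sum {p q m : ℕ} (hp : p.Prime) {F K : Type*} [Field F] [Finite F]
    [Field K] [Finite K] [Algebra F K] [CharP F p] (hq : Nat.card F = q)
    (hm : Module.finrank F K = m) (hpq : p ∣ q) (hq2 : 2 ≤ q) (α : K) (t : ℕ) :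
    algebraMap F K (traceSeq F α (q ^ m - 2) t) =
      ∑ i ∈ (Finset.range (q ^ m - 1)).filter (fun i => ¬ digitSum q i + m ≡ 0 [MOD p]),
        ((-1) ^ i * ((digitSum q i + m : ℕ) : K)) * (α ^ i) ^ t := by
  have hKp : CharP K p := charP_of_injective_algebraMap (algebraMap F K).injective p
  have hpos : 0 < q ^ m := Nat.pow_pos (by omega)
  have h := algebraMap_trace_one_sub_pow hp hq hm (-α ^ t)
  rw [sub_neg_eq_add] at h
  rw [traceSeq, h]
  symm
  refine (Finset.sum_subset (s₂ := Finset.range (q ^ m)) (fun i hi => ?_) fun i hi hi' => ?_).trans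
    (Finset.sum_congr rfl fun i _ => ?_)
  · have := (Finset.mem_filter.1 hi).1
    rw [Finset.mem_range] at this ⊢
    omega
  · have h0 : p ∣ digitSum q i + m := by
      by_contra hnd
      refine hi' (Finset.mem_filter.2 ⟨?_, fun h => hnd ((Nat.modEq_zero_iff_dvd).1 h)⟩)
      rw [Finset.mem_range] at hi ⊢
      refine lt_of_le_of_ne (by omega) fun e => hnd ?_
      rw [e, digitSum_pow_sub_one_add hq2]
      exact hpq.mul_left m
    rw [(CharP.cast_eq_zero_iff K p _).2 h0]
    ring
  · rw [neg_pow (α ^ t), ← pow_mul, ← pow_mul, mul_comm t]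
    ring

/-! ### Zeros of the generator polynomial. -/

theorem prod_X_sub_C_inv_eval_pow_eq_zero {p q m : ℕ} (hpq : p ∣ q) (hq2 : 2 ≤ q)
    {K : Type*} [Field K] {α : K} (hα : IsPrimitiveRoot α (q ^ m - 1)) {k : ℕ} (hk : 0 < k)
    (hkn : k ≤ q ^ m - 1) (hd : ¬ p ∣ digitSum q k) :
    (∏ i ∈ (Finset.range (q ^ m - 1)).filter (fun i => ¬ digitSum q i + m ≡ 0 [MOD p]),
      (X - C ((α ^ i)⁻¹))).eval (α ^ k) = 0 := by
  rw [eval_prod]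
  -- The complementary index has inverse power α^k, and its digit sum plus m is mq - s_q(k), with p
  -- ∣ q.
  refine Finset.prod_eq_zero (i := q ^ m - 1 - k) ?_ ?_
  · rw [Finset.mem_filter, Finset.mem_range, Nat.modEq_zero_iff_dvd]
    refine ⟨by omega, fun h => hd ?_⟩
    have := digitSum_pow_sub_one_sub hq2 m k (by omega)
    have h2 : digitSum q (q ^ m - 1 - k) + m + digitSum q k = m * q := by
      obtain ⟨l, rfl⟩ := Nat.exists_eq_add_of_le' (show 1 ≤ q by omega)
      rw [add_right_comm, this, Nat.add_sub_cancel]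
      ring
    exact (Nat.dvd_add_right h).1 (h2 ▸ hpq.mul_left m)
  · have h0 : α ≠ 0 := hα.ne_zero (by omega)
    have : α ^ k * α ^ (q ^ m - 1 - k) = 1 := by
      rw [← pow_add, Nat.add_sub_cancel' hkn, hα.pow_eq_one]
    rw [eval_sub, eval_X, eval_C, eq_inv_of_mul_eq_one_left this, sub_self]

/-- With q = pk, the digits of pj are p(j mod k) and j / k, so its digit sum is j / k modulo p,
which lies strictly between 0 and p. -/
theorem prod_X_sub_C_inv_eval_mul_pow_eq_zero {p k m : ℕ} (hp : p.Prime) (hk : 0 < k)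
    (hm : 0 < m) {K : Type*} [Field K] {α : K}
    (hα : IsPrimitiveRoot α ((p * k) ^ m - 1)) {j : ℕ} (hkj : k ≤ j) (hj : j < p * k) :
    (∏ i ∈ (Finset.range ((p * k) ^ m - 1)).filter
        (fun i => ¬ digitSum (p * k) i + m ≡ 0 [MOD p]),
      (X - C ((α ^ i)⁻¹))).eval ((α ^ p) ^ j) = 0 := by
  have hp2 := hp.two_le
  have hq2 : 2 ≤ p * k := hp2.trans (Nat.le_mul_of_pos_right p hk)
  have ha1 : 0 < j / k := Nat.div_pos hkj hk
  have ha2 : j / k < p := Nat.div_lt_of_lt_mul (by rwa [mul_comm])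
  have hb : j % k < k := Nat.mod_lt _ hk
  have hpb : p * (j % k) + p ≤ p * k := by
    calc p * (j % k) + p = p * (j % k + 1) := by ring
      _ ≤ p * k := Nat.mul_le_mul_left _ hb
  have hnd : ¬ p ∣ p * (j % k) + j / k := fun h =>
    Nat.not_dvd_of_pos_of_lt ha1 ha2 ((Nat.dvd_add_right (dvd_mul_right _ _)).1 h)
  have hpj : p * j = p * (j % k) + p * k * (j / k) := by
    conv_lhs => rw [← Nat.mod_add_div j k]
    ring
  rw [← pow_mul]
  -- For m = 1 there is no second digit; α^q = α folds it onto the first, and the sum stays below q.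
  rcases Nat.eq_or_lt_of_le (show 1 ≤ m from hm) with rfl | hm2
  · have hαq : α ^ (p * k) = α := by
      have := hα.pow_eq_one
      rw [pow_one] at this
      obtain ⟨l, hl⟩ := Nat.exists_eq_add_of_le' (show 1 ≤ p * k by omega)
      rw [hl, Nat.add_sub_cancel] at this
      rw [hl, pow_succ, this, one_mul]
    rw [hpj, pow_add, pow_mul α (p * k), hαq, ← pow_add]
    refine prod_X_sub_C_inv_eval_pow_eq_zero (dvd_mul_right _ _) hq2 hα (by omega) ?_ ?_
    · rw [pow_one]
      omega
    · rwa [digitSum_of_lt hq2 (by omega)]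
  · refine prod_X_sub_C_inv_eval_pow_eq_zero (dvd_mul_right _ _) hq2 hα
      (Nat.mul_pos hp.pos (by omega)) ?_ ?_
    · have h1 : p * j + p ≤ p * (p * k) := by
        calc p * j + p = p * (j + 1) := by ring
          _ ≤ _ := Nat.mul_le_mul_left _ hj
      have h2 : p * (p * k) ≤ (p * k) * (p * k) :=
        Nat.mul_le_mul_right _ (Nat.le_mul_of_pos_right p hk)
      have h3 : (p * k) ^ 2 ≤ (p * k) ^ m := Nat.pow_le_pow_right (by omega) hm2
      rw [pow_two] at h3
      omega
    · rw [hpj, digitSum_add_mul hq2 (by omega), digitSum_of_lt hq2 (by omega)]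
      exact hnd

theorem minDistance_eq_top_of_finrank_eq_zero {F : Type*} [Field F] {n : ℕ}
    (C : Submodule F (Fin n → F)) (h : Module.finrank F C = 0) : minDistance C = ⊤ := by
  have hC : C = ⊥ := Submodule.finrank_eq_zero.1 h
  subst hC
  unfold minDistance
  simp only [iInf_eq_top]
  intro x hx y hy hxy
  rw [Submodule.mem_bot] at hx hy
  exact absurd (hx.trans hy.symm) hxy

/-! ### Assembly and the choice of the better bound. -/

theorem mainTheorem2 (p q m : ℕ) (hp : p.Prime)
    (F K : Type*) [Field F] [Finite F] [Field K] [Finite K] [Algebra F K] [CharP F p]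
    (hq : Nat.card F = q) (hm : Module.finrank F K = m)
    (α : K) (hα : IsPrimitiveRoot α (q ^ m - 1)) :
    (∃! M : F[X], IsSeqMinpoly (traceSeq F α (q ^ m - 2)) M) ∧
    ∀ M : F[X], IsSeqMinpoly (traceSeq F α (q ^ m - 2)) M →
      IsCyclicCode (codeOf (q ^ m - 1) M) ∧
      (∃ g : F[X],
        g.map (algebraMap F K) =
          ∏ i ∈ (Finset.range (q ^ m - 1)).filter (fun i => ¬ digitSum q i + m ≡ 0 [MOD p]),
            (X - C ((α ^ i)⁻¹)) ∧
        Associated M g ∧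
        IsGeneratorPoly (codeOf (q ^ m - 1) M) g) ∧
      (Module.finrank F (codeOf (q ^ m - 1) M) : ℚ) = (q : ℚ) ^ m / p - 1 ∧
      ((max (2 * p - 1) (q * (p - 1) / p + 1) : ℕ) : ℕ∞) ≤ minDistance (codeOf (q ^ m - 1) M) := by
  have := Fact.mk hp
  have hKp : CharP K p := charP_of_injective_algebraMap (algebraMap F K).injective p
  have hmpos : 0 < m := hm ▸ Module.finrank_pos
  have hp2 := hp.two_le
  -- The dichotomy decides the maximum: 2p - 1 wins for q = p, the other bound as soon as p ≤ k.
  obtain ⟨k, hk, hqk, hk1⟩ : ∃ k, 0 < k ∧ q = p * k ∧ (k = 1 ∨ p ≤ k) := by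
    have : Fintype F := Fintype.ofFinite F
    obtain ⟨N, -, hqN⟩ := FiniteField.card F p
    rw [← Nat.card_eq_fintype_card, hq] at hqN
    obtain ⟨l, hl⟩ := Nat.exists_eq_succ_of_ne_zero N.ne_zero
    refine ⟨p ^ l, Nat.pow_pos hp.pos, by rw [hqN, hl, pow_succ'], ?_⟩
    rcases Nat.eq_zero_or_pos l with rfl | h
    · exact Or.inl (pow_zero p)
    · exact Or.inr (Nat.le_self_pow h.ne' p)
  have hpq : p ∣ q := ⟨k, hqk⟩
  have hq2 : 2 ≤ q := hqk ▸ hp2.trans (Nat.le_mul_of_pos_right p hk)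
  have hQ : q ≤ q ^ m := Nat.le_self_pow hmpos.ne' q
  have hn : 0 < q ^ m - 1 := by omega
  have hα0 : α ≠ 0 := hα.ne_zero hn.ne'
  set S := (Finset.range (q ^ m - 1)).filter (fun i => ¬ digitSum q i + m ≡ 0 [MOD p]) with hS
  have hinj : Set.InjOn (fun i => α ^ i) S := fun i hi j hj e =>
    hα.pow_inj (Finset.mem_range.1 (Finset.mem_filter.1 hi).1)
      (Finset.mem_range.1 (Finset.mem_filter.1 hj).1) e
  have hβ : ∀ i ∈ S, α ^ i ≠ 0 := fun i _ => pow_ne_zero i hα0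
  have hc : ∀ i ∈ S, (-1) ^ i * ((digitSum q i + m : ℕ) : K) ≠ 0 := fun i hi =>
    mul_ne_zero (pow_ne_zero _ (neg_ne_zero.2 one_ne_zero)) fun h =>
      (Finset.mem_filter.1 hi).2
        ((Nat.modEq_zero_iff_dvd).2 ((CharP.cast_eq_zero_iff K p _).1 h))
  have hs := algebraMap_traceSeq_eq_sum hp hq hm hpq hq2 α
  have hcard : S.card + q ^ m / p = q ^ m := by
    have h1 := card_filter_digitSum_modEq hp hpq hq2 hmpos m
    have h2 := Finset.card_filter_add_card_filter_not (s := Finset.range (q ^ m))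
      (fun i => digitSum q i + m ≡ 0 [MOD p])
    have h3 : (Finset.range (q ^ m)).filter (fun i => ¬ digitSum q i + m ≡ 0 [MOD p]) = S := by
      obtain ⟨n, hn'⟩ := Nat.exists_eq_add_of_le' (show 1 ≤ q ^ m by omega)
      have h4 : digitSum q n + m ≡ 0 [MOD p] := by
        have := digitSum_pow_sub_one_add hq2 m
        rw [hn', Nat.add_sub_cancel] at this
        rw [this, Nat.modEq_zero_iff_dvd]
        exact hpq.mul_left m
      rw [hS, hn', Nat.add_sub_cancel, Finset.range_add_one, Finset.filter_insert,
        if_neg (not_not.2 h4)]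
    rw [h1, h3, Finset.card_range] at h2
    omega
  have hSne : S.Nonempty := by
    rw [← Finset.card_pos]
    have : q ^ m / p < q ^ m := Nat.div_lt_self (by omega) hp2
    omega
  obtain ⟨g, hg⟩ := exists_map_eq_prod_X_sub_C_inv S _ _ hc hβ hinj _ hs
  have hiff := isSeqMinpoly_iff S hSne _ _ hc hβ hinj _ hs g hg
  refine ⟨⟨_, (hiff _).2 rfl, fun M hM => (hiff M).1 hM⟩, fun M hM => ?_⟩
  have hgmon : g.Monic := by
    refine monic_of_injective (algebraMap F K).injective ?_
    rw [hg]
    exact monic_prod_of_monic _ _ fun _ _ => monic_X_sub_C _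
  have hgdeg : g.natDegree = S.card := by
    rw [← natDegree_map (algebraMap F K), hg,
      natDegree_prod_of_monic _ _ fun k _ => monic_X_sub_C _]
    simp
  have hg0 : g.coeff 0 ≠ 0 := by
    rw [← (algebraMap F K).injective.ne_iff, map_zero, ← coeff_map, hg, coeff_zero_eq_eval_zero,
      eval_prod]
    exact Finset.prod_ne_zero_iff.2 fun i _ => by simp [hα0]
  have hgd : g ∣ X ^ (q ^ m - 1) - 1 := by
    rw [← map_dvd_map' (algebraMap F K), hg, prod_X_sub_C_dvd_iff S (fun i => (α ^ i)⁻¹)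
      fun i hi j hj e => hinj hi hj (inv_injective e)]
    intro i _
    simp [← pow_mul, mul_comm i, pow_mul α (q ^ m - 1), hα.pow_eq_one]
  have hassoc : Associated M g := by
    rw [(hiff M).1 hM]
    exact associated_unit_mul_left _ _ (isUnit_C.2 (inv_ne_zero hg0).isUnit)
  have hcode : codeOf (q ^ m - 1) M = codeOf (q ^ m - 1) g := by
    rw [codeOf, codeOf, cyclicIdeal_eq_of_associated hassoc]
  have hrank := finrank_codeOf_add_natDegree hgmon hgd (n := q ^ m - 1) (by
    rw [hgdeg]
    exact (Finset.card_filter_le _ _).trans (Finset.card_range _).le)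
  refine ⟨isCyclicCode_codeOf _ M, ⟨g, hg, hassoc, isGeneratorPoly_codeOf hn hgmon hgd hassoc⟩,
    ?_, ?_⟩
  · have h1 : Module.finrank F (codeOf (q ^ m - 1) g) + 1 = q ^ m / p := by omega
    rw [hcode, eq_sub_iff_add_eq, ← Nat.cast_pow, ← Nat.cast_div (hpq.trans (dvd_pow_self q hmpos.ne'))
      (by exact_mod_cast hp.ne_zero), ← h1]
    push_cast
    rfl
  · rw [hcode]
    have hdiv : q * (p - 1) / p = k * (p - 1) := by
      rw [hqk, mul_assoc, Nat.mul_div_cancel_left _ hp.pos]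
    have hkp : k + k * (p - 1) = p * k := by
      obtain ⟨r, rfl⟩ := Nat.exists_eq_add_of_le' (show 1 ≤ p by omega)
      rw [Nat.add_sub_cancel]
      ring
    have hb1 : ((k * (p - 1) + 1 : ℕ) : ℕ∞) ≤ minDistance (codeOf (q ^ m - 1) g) := by
      have hcop : p.Coprime (q ^ m - 1) := by
        rw [hp.coprime_iff_not_dvd]
        intro h
        have h1 : p ∣ q ^ m - 1 + 1 := by
          rw [Nat.sub_add_cancel (by omega)]
          exact hpq.trans (dvd_pow_self q hmpos.ne')
        exact hp.one_lt.ne' (Nat.dvd_one.1 ((Nat.dvd_add_right h).1 h1))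
      refine le_minDistance_codeOf hgd (α ^ p) (hα.pow_of_coprime p hcop) k _ fun j hj => ?_
      rw [← eval_map_algebraMap, hg, hS]
      subst hqk
      exact prod_X_sub_C_inv_eval_mul_pow_eq_zero hp hk hmpos hα (by omega) (by omega)
    rw [hdiv]
    rcases hk1 with rfl | hpk
    · rw [mul_one] at hqk
      subst hqk
      rcases Nat.eq_or_lt_of_le (show 1 ≤ m from hmpos) with rfl | hm2
      · rw [minDistance_eq_top_of_finrank_eq_zero]
        · exact le_top
        · have : q ^ 1 / q = 1 := by rw [pow_one, Nat.div_self hp.pos]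
          omega
      -- Here q = p and m ≥ 2: the exponents 1, …, 2p - 2 all have digit sum between 1 and p - 1.
      · have hmax : max (2 * q - 1) (1 * (q - 1) + 1) = 2 * q - 2 + 1 := by omega
        rw [hmax]
        refine le_minDistance_codeOf hgd α hα 1 _ fun j hj => ?_
        rw [← eval_map_algebraMap, hg, hS]
        refine prod_X_sub_C_inv_eval_pow_eq_zero dvd_rfl hp2 hα (by omega) ?_ ?_
        · have h3 : q ^ 2 ≤ q ^ m := Nat.pow_le_pow_right (by omega) hm2
          have h4 : 2 * q ≤ q ^ 2 := by rw [pow_two]; exact Nat.mul_le_mul_right q hp2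
          omega
        · rcases lt_or_ge (1 + j) q with h | h
          · rw [digitSum_of_lt hp2 h]
            exact Nat.not_dvd_of_pos_of_lt (by omega) h
          · have e : 1 + j = (1 + j - q) + q * 1 := by omega
            rw [e, digitSum_add_mul hp2 (by omega), digitSum_of_lt hp2 (by omega)]
            exact Nat.not_dvd_of_pos_of_lt (by omega) (by omega)
    · rw [max_eq_right]
      · exact hb1
      · have h5 : p * (p - 1) ≤ k * (p - 1) := Nat.mul_le_mul_right _ hpk
        have h6 : 2 * (p - 1) ≤ p * (p - 1) := Nat.mul_le_mul_right _ hp2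
        omega
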